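/- Let $\mathscr{H}_1,\mathscr{H}_2$ be finite-dimensional complex Hilbert spaces of dimensions $d_1,d_2$, let $d=\max\{d_1,d_2\}$, let $C$ be a linear operator on $\mathscr{H}_1\otimes\mathscr{H}_2$, and let $r=\operatorname{rank}C$. Write $\|T\|_2=(\operatorname{tr}T^*T)^{1/2}$ for the Hilbert–Schmidt norm, and let $\operatorname{tr}_1,\operatorname{tr}_2$ be the partial traces, i.e. the linear maps determined by $\operatorname{tr}_1(A\otimes B)=\operatorname{tr}(A)\,B$ and $\operatorname{tr}_2(A\otimes B)=\operatorname{tr}(B)\,A$. (For $C=0$ the terms $|\operatorname{tr}C|^2/0$ are read as $0$.) Then 1. $\displaystyle \Bigl|\,\|\operatorname{tr}_1C\|_2^2-\|\operatorname{tr}_2C\|_2^2\,\Bigr|\le \min\{r,d\}\,\|C\|_2^2-\frac{1}{\min\{r,d\}}\,|\operatorname{tr}C|^2$; 2. $\displaystyle \|\operatorname{tr}_1C\|_2^2+\|\operatorname{tr}_2C\|_2^2\le d\,\|C\|_2^2+\frac1d\,|\operatorname{tr}C|^2$. 3. If, in addition, $C=C_1+C_2$ where $\operatorname{rank}C_1=1$,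 $C_2$ is normal, and every eigenvector of $C_2$ with nonzero eigenvalue is orthogonal to the range of $C_1$ and to the range of $C_1^*$, then $$\|\operatorname{tr}_1C\|_2^2+\|\operatorname{tr}_2C\|_2^2\le r\,\|C\|_2^2+\frac1r\,|\operatorname{tr}C|^2 .$$ -/

import Mathlib

open scoped TensorProduct

noncomputable section

/-- The Hilbert-Schmidt (Schatten `2`-) norm `‖T‖₂ = (tr (T* T))^(1/2)` of a linear operator
on a finite-dimensional complex Hilbert space. -/
def hsNorm {H : Type*} [NormedAddCommGroup H] [InnerProductSpace ℂ H] [FiniteDimensional ℂ H]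
    (T : H →ₗ[ℂ] H) : ℝ :=
  Real.sqrt (LinearMap.trace ℂ H (LinearMap.adjoint T ∘ₗ T)).re

/-- The partial trace over the first factor: the linear map
`L(H₁ ⊗ H₂) → L(H₂)` with `tr₁ (A ⊗ B) = tr A • B`. -/
def partialTrace₁ {H₁ H₂ : Type*} [NormedAddCommGroup H₁] [InnerProductSpace ℂ H₁]
    [FiniteDimensional ℂ H₁] [NormedAddCommGroup H₂] [InnerProductSpace ℂ H₂]
    [FiniteDimensional ℂ H₂] :
    (H₁ ⊗[ℂ] H₂ →ₗ[ℂ] H₁ ⊗[ℂ] H₂) →ₗ[ℂ] (H₂ →ₗ[ℂ] H₂) :=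
  TensorProduct.lift ((LinearMap.lsmul ℂ (H₂ →ₗ[ℂ] H₂)) ∘ₗ LinearMap.trace ℂ H₁) ∘ₗ
    (homTensorHomEquiv ℂ H₁ H₂ H₁ H₂).symm.toLinearMap

/-- The partial trace over the second factor: the linear map
`L(H₁ ⊗ H₂) → L(H₁)` with `tr₂ (A ⊗ B) = tr B • A`. -/
def partialTrace₂ {H₁ H₂ : Type*} [NormedAddCommGroup H₁] [InnerProductSpace ℂ H₁]
    [FiniteDimensional ℂ H₁] [NormedAddCommGroup H₂] [InnerProductSpace ℂ H₂]
    [FiniteDimensional ℂ H₂] :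
    (H₁ ⊗[ℂ] H₂ →ₗ[ℂ] H₁ ⊗[ℂ] H₂) →ₗ[ℂ] (H₁ →ₗ[ℂ] H₁) :=
  TensorProduct.lift ((LinearMap.lsmul ℂ (H₁ →ₗ[ℂ] H₁)) ∘ₗ LinearMap.trace ℂ H₂).flip ∘ₗ
    (homTensorHomEquiv ℂ H₁ H₂ H₁ H₂).symm.toLinearMap

/-- The partial trace over the first factor on elementary tensors. -/
theorem partialTrace₁_map {H₁ H₂ : Type*} [NormedAddCommGroup H₁] [InnerProductSpace ℂ H₁]
    [FiniteDimensional ℂ H₁] [NormedAddCommGroup H₂] [InnerProductSpace ℂ H₂]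
    [FiniteDimensional ℂ H₂] (A : H₁ →ₗ[ℂ] H₁) (B : H₂ →ₗ[ℂ] H₂) :
    partialTrace₁ (TensorProduct.map A B) = LinearMap.trace ℂ H₁ A • B := by
  have h : (homTensorHomEquiv ℂ H₁ H₂ H₁ H₂).symm (TensorProduct.map A B) = A ⊗ₜ[ℂ] B := by
    rw [LinearEquiv.symm_apply_eq]; simp
  simp [partialTrace₁, h]

/-- The partial trace over the second factor on elementary tensors. -/
theorem partialTrace₂_map {H₁ H₂ : Type*} [NormedAddCommGroup H₁] [InnerProductSpace ℂ H₁]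
    [FiniteDimensional ℂ H₁] [NormedAddCommGroup H₂] [InnerProductSpace ℂ H₂]
    [FiniteDimensional ℂ H₂] (A : H₁ →ₗ[ℂ] H₁) (B : H₂ →ₗ[ℂ] H₂) :
    partialTrace₂ (TensorProduct.map A B) = LinearMap.trace ℂ H₂ B • A := by
  have h : (homTensorHomEquiv ℂ H₁ H₂ H₁ H₂).symm (TensorProduct.map A B) = A ⊗ₜ[ℂ] B := by
    rw [LinearEquiv.symm_apply_eq]; simp
  simp [partialTrace₂, h]

end

/-! Two independent mechanisms are at work, one for rank and one for dimension.

Rank. Write C = ∑ |a_k⟩⟨b_k| with r terms and b orthonormal, so that ‖C‖₂² = ∑ ‖a_k‖² and tr C = ∑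
⟨b_k, a_k⟩. On two copies of H₁ ⊗ H₂ let F₁, F₂ exchange the copies of one factor; these are
commuting symmetric involutions whose product F is the full swap. The Hilbert-Schmidt pairing of the
i-th partial traces of |a⟩⟨b| and |a'⟩⟨b'| is ⟨a ⊗ b', F_i (a' ⊗ b)⟩, so everything reduces to
inequalities for pairs (l, k), all drawn from ‖(1 ± F)(u - F₁ w)‖² ≥ 0
(`two_re_inner_involutions_le`). The minus sign bounds the difference of the partial trace norms.
The plus sign bounds their sum, but alone does not give the trace term with coefficient 1/r. In part
3 each pair contains a normal term c|v⟩⟨v| with v orthogonal to the other term, and polarization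
(`two_swapForm_le`) gains |z_k - z_l|²/2, where z_k = ⟨b_k, a_k⟩. Summing these gains turns ∑ |z_k|²
into |tr C|²/r.

Dimension. Subtracting from C its projection onto the span of the operators 1 ⊗ T and T ⊗ 1 leaves
an operator of nonnegative squared norm (`hsNorm_sq_partialTrace_div_add_le`). With Cauchy-Schwarz
for traces this yields part 2, and part 1 with d in place of r. -/

/-! ### Rank-one operators and the Hilbert-Schmidt inner product -/

/-- The rank-one operator `|a⟩⟨b|`. -/
noncomputable def ketBra {H : Type*} [NormedAddCommGroup H] [InnerProductSpace ℂ H] (a b : H) :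
    H →ₗ[ℂ] H :=
  (innerₛₗ ℂ b).smulRight a

/-- The Hilbert-Schmidt inner product `tr (T* S)`. -/
noncomputable def hsInner {H : Type*} [NormedAddCommGroup H] [InnerProductSpace ℂ H]
    [FiniteDimensional ℂ H] (T S : H →ₗ[ℂ] H) : ℂ :=
  LinearMap.trace ℂ H (LinearMap.adjoint T ∘ₗ S)

section HilbertSchmidt

variable {H : Type*} [NormedAddCommGroup H] [InnerProductSpace ℂ H]

@[simp] theorem ketBra_apply (a b z : H) : ketBra a b z = inner ℂ b z • a := by
  simp [ketBra]

@[simp] theorem ketBra_zero_left (b : H) : ketBra 0 b = 0 := by ext; simp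

@[simp] theorem ketBra_zero_right (a : H) : ketBra a 0 = 0 := by ext; simp

theorem ketBra_add_left (a a' b : H) : ketBra (a + a') b = ketBra a b + ketBra a' b := by
  ext; simp

theorem ketBra_add_right (a b b' : H) : ketBra a (b + b') = ketBra a b + ketBra a b' := by
  ext; simp [add_smul]

theorem ketBra_comp_ketBra (a b a' b' : H) :
    ketBra a b ∘ₗ ketBra a' b' = inner ℂ b a' • ketBra a b' := by
  ext; simp [smul_smul, mul_comm]

variable [FiniteDimensional ℂ H]

@[simp] theorem adjoint_ketBra (a b : H) : LinearMap.adjoint (ketBra a b) = ketBra b a := by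
  symm
  rw [LinearMap.eq_adjoint_iff]
  intro x y
  simp [inner_smul_left, inner_smul_right, mul_comm]

@[simp] theorem trace_ketBra (a b : H) : LinearMap.trace ℂ H (ketBra a b) = inner ℂ b a := by
  simp [ketBra, LinearMap.trace_smulRight]

@[simp] theorem hsInner_ketBra (a b a' b' : H) :
    hsInner (ketBra a b) (ketBra a' b') = inner ℂ a a' * inner ℂ b' b := by
  simp [hsInner, ketBra_comp_ketBra]

@[simp] theorem hsInner_zero_left (S : H →ₗ[ℂ] H) : hsInner 0 S = 0 := by simp [hsInner]

@[simp] theorem hsInner_zero_right (S : H →ₗ[ℂ] H) : hsInner S 0 = 0 := by simp [hsInner]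

theorem hsInner_add_left (T T' S : H →ₗ[ℂ] H) :
    hsInner (T + T') S = hsInner T S + hsInner T' S := by
  simp [hsInner, LinearMap.add_comp]

theorem hsInner_add_right (T S S' : H →ₗ[ℂ] H) :
    hsInner T (S + S') = hsInner T S + hsInner T S' := by
  simp [hsInner, LinearMap.comp_add]

theorem hsInner_smul_left (z : ℂ) (T S : H →ₗ[ℂ] H) :
    hsInner (z • T) S = (starRingEnd ℂ) z * hsInner T S := by
  rw [hsInner, map_smulₛₗ, LinearMap.smul_comp, map_smul, smul_eq_mul, hsInner]

theorem hsInner_smul_right (z : ℂ) (T S : H →ₗ[ℂ] H) :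
    hsInner T (z • S) = z * hsInner T S := by
  simp [hsInner, LinearMap.comp_smul]

theorem hsInner_sub_left (T T' S : H →ₗ[ℂ] H) :
    hsInner (T - T') S = hsInner T S - hsInner T' S := by
  simp [hsInner, LinearMap.sub_comp]

theorem hsInner_sub_right (T S S' : H →ₗ[ℂ] H) :
    hsInner T (S - S') = hsInner T S - hsInner T S' := by
  simp [hsInner, LinearMap.comp_sub]

theorem hsInner_sum_left {ι : Type*} (s : Finset ι) (T : ι → H →ₗ[ℂ] H) (S : H →ₗ[ℂ] H) :
    hsInner (∑ i ∈ s, T i) S = ∑ i ∈ s, hsInner (T i) S := by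
  classical
  induction s using Finset.induction_on with
  | empty => simp
  | insert i s hi ih => simp [Finset.sum_insert hi, hsInner_add_left, ih]

theorem hsInner_sum_right {ι : Type*} (s : Finset ι) (T : ι → H →ₗ[ℂ] H) (S : H →ₗ[ℂ] H) :
    hsInner S (∑ i ∈ s, T i) = ∑ i ∈ s, hsInner S (T i) := by
  classical
  induction s using Finset.induction_on with
  | empty => simp
  | insert i s hi ih => simp [Finset.sum_insert hi, hsInner_add_right, ih]

theorem hsInner_conj_symm (T S : H →ₗ[ℂ] H) :
    (starRingEnd ℂ) (hsInner T S) = hsInner S T := by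
  have h : LinearMap.adjoint S ∘ₗ T = LinearMap.adjoint (LinearMap.adjoint T ∘ₗ S) := by
    rw [LinearMap.adjoint_comp, LinearMap.adjoint_adjoint]
  rw [hsInner, hsInner, h,
    LinearMap.trace_eq_sum_inner _ (stdOrthonormalBasis ℂ H),
    LinearMap.trace_eq_sum_inner _ (stdOrthonormalBasis ℂ H), map_sum]
  refine Finset.sum_congr rfl fun i _ => ?_
  rw [LinearMap.adjoint_inner_right, inner_conj_symm]

theorem hsInner_self_re_nonneg (T : H →ₗ[ℂ] H) : 0 ≤ (hsInner T T).re := by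
  have := (LinearMap.isPositive_adjoint_comp_self T).trace_nonneg
  exact (Complex.le_def.1 this).1

theorem hsNorm_sq (T : H →ₗ[ℂ] H) : hsNorm T ^ 2 = (hsInner T T).re :=
  Real.sq_sqrt (hsInner_self_re_nonneg T)

@[simp] theorem hsInner_id_left (T : H →ₗ[ℂ] H) :
    hsInner LinearMap.id T = LinearMap.trace ℂ H T := by
  have h : LinearMap.adjoint (LinearMap.id : H →ₗ[ℂ] H) = LinearMap.id := by
    symm
    rw [LinearMap.eq_adjoint_iff]
    simp
  rw [hsInner, h, LinearMap.id_comp]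

end HilbertSchmidt

/-! ### Two copies of a space and their swap -/

section TensorSquare

/-- The tensor square `X ⊗ X`, with the inner product of the tensor product. -/
abbrev TensorSquare (X : Type*) [NormedAddCommGroup X] [InnerProductSpace ℂ X] : Type _ := X ⊗[ℂ] X

variable {X : Type*} [NormedAddCommGroup X] [InnerProductSpace ℂ X]

/-- The elementary tensor `x ⊗ y` in the tensor square. -/
noncomputable def sqMk : X →ₗ[ℂ] X →ₗ[ℂ] TensorSquare X := TensorProduct.mk ℂ X X

@[simp] theorem inner_sqMk (x y x' y' : X) :
    inner ℂ (sqMk x y) (sqMk x' y') = inner ℂ x x' * inner ℂ y y' := rfl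

theorem tensorSquare_induction {P : TensorSquare X → Prop} (zero : P 0)
    (mk : ∀ x y, P (sqMk x y)) (add : ∀ u w, P u → P w → P (u + w)) (u : TensorSquare X) : P u :=
  TensorProduct.induction_on u zero mk add

/-- The operator exchanging the two factors of the tensor square. -/
noncomputable def swapSq : TensorSquare X →ₗ[ℂ] TensorSquare X :=
  (TensorProduct.comm ℂ X X).toLinearMap

@[simp] theorem swapSq_sqMk (x y : X) : swapSq (sqMk x y) = sqMk y x := rfl

end TensorSquare

/-! ### Partial swaps on two copies of a bipartite space -/

section Swap

variable {H₁ H₂ : Type*} [NormedAddCommGroup H₁] [InnerProductSpace ℂ H₁]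
  [NormedAddCommGroup H₂] [InnerProductSpace ℂ H₂]

/-- The operator on `H ⊗ H` with `H = H₁ ⊗ H₂` exchanging the two copies of `H₁`. -/
noncomputable def swapFst (H₁ H₂ : Type*) [NormedAddCommGroup H₁] [InnerProductSpace ℂ H₁]
    [NormedAddCommGroup H₂] [InnerProductSpace ℂ H₂] :
    TensorSquare (H₁ ⊗[ℂ] H₂) →ₗ[ℂ] TensorSquare (H₁ ⊗[ℂ] H₂) :=
  (TensorProduct.tensorTensorTensorComm ℂ H₁ H₁ H₂ H₂).toLinearMap ∘ₗ
    TensorProduct.map (TensorProduct.comm ℂ H₁ H₁).toLinearMap LinearMap.id ∘ₗ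
    (TensorProduct.tensorTensorTensorComm ℂ H₁ H₂ H₁ H₂).toLinearMap

/-- The operator on `H ⊗ H` with `H = H₁ ⊗ H₂` exchanging the two copies of `H₂`. -/
noncomputable def swapSnd (H₁ H₂ : Type*) [NormedAddCommGroup H₁] [InnerProductSpace ℂ H₁]
    [NormedAddCommGroup H₂] [InnerProductSpace ℂ H₂] :
    TensorSquare (H₁ ⊗[ℂ] H₂) →ₗ[ℂ] TensorSquare (H₁ ⊗[ℂ] H₂) :=
  (TensorProduct.tensorTensorTensorComm ℂ H₁ H₁ H₂ H₂).toLinearMap ∘ₗ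
    TensorProduct.map LinearMap.id (TensorProduct.comm ℂ H₂ H₂).toLinearMap ∘ₗ
    (TensorProduct.tensorTensorTensorComm ℂ H₁ H₂ H₁ H₂).toLinearMap

@[simp] theorem swapFst_sqMk (a b : H₁) (a' b' : H₂) :
    swapFst H₁ H₂ (sqMk (a ⊗ₜ a') (b ⊗ₜ b')) = sqMk (b ⊗ₜ a') (a ⊗ₜ b') := rfl

@[simp] theorem swapSnd_sqMk (a b : H₁) (a' b' : H₂) :
    swapSnd H₁ H₂ (sqMk (a ⊗ₜ a') (b ⊗ₜ b')) = sqMk (a ⊗ₜ b') (b ⊗ₜ a') := rfl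

theorem tensorSquare_induction_tmul
    {P : TensorSquare (H₁ ⊗[ℂ] H₂) → Prop} (zero : P 0)
    (mk : ∀ (a b : H₁) (a' b' : H₂), P (sqMk (a ⊗ₜ a') (b ⊗ₜ b')))
    (add : ∀ u w, P u → P w → P (u + w)) (u : TensorSquare (H₁ ⊗[ℂ] H₂)) : P u := by
  induction u using tensorSquare_induction with
  | zero => exact zero
  | add u w hu hw => exact add u w hu hw
  | mk x y =>
    induction x with
    | zero => rw [map_zero]; exact zero
    | add x x' hx hx' => rw [map_add]; exact add _ _ hx hx'
    | tmul a a' =>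
      induction y with
      | zero => rw [map_zero]; exact zero
      | add y y' hy hy' => rw [map_add]; exact add _ _ hy hy'
      | tmul b b' => exact mk a b a' b'

theorem swapFst_swapFst (u : TensorSquare (H₁ ⊗[ℂ] H₂)) :
    swapFst H₁ H₂ (swapFst H₁ H₂ u) = u := by
  induction u using tensorSquare_induction_tmul with
  | zero => simp
  | mk a b a' b' => simp
  | add u w hu hw => simp [hu, hw]

theorem swapSnd_swapSnd (u : TensorSquare (H₁ ⊗[ℂ] H₂)) :
    swapSnd H₁ H₂ (swapSnd H₁ H₂ u) = u := by
  induction u using tensorSquare_induction_tmul with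
  | zero => simp
  | mk a b a' b' => simp
  | add u w hu hw => simp [hu, hw]

theorem swapFst_swapSnd (u : TensorSquare (H₁ ⊗[ℂ] H₂)) :
    swapFst H₁ H₂ (swapSnd H₁ H₂ u) = swapSq u := by
  induction u using tensorSquare_induction_tmul with
  | zero => simp
  | mk a b a' b' => simp
  | add u w hu hw => simp [hu, hw]

theorem swapSnd_swapFst (u : TensorSquare (H₁ ⊗[ℂ] H₂)) :
    swapSnd H₁ H₂ (swapFst H₁ H₂ u) = swapSq u := by
  induction u using tensorSquare_induction_tmul with
  | zero => simp
  | mk a b a' b' => simp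
  | add u w hu hw => simp [hu, hw]

theorem swapFst_isSymmetric : (swapFst H₁ H₂).IsSymmetric := by
  intro u w
  induction u using tensorSquare_induction_tmul with
  | zero => simp
  | add u u' hu hu' => simp only [map_add, inner_add_left, hu, hu']
  | mk a b a' b' =>
    induction w using tensorSquare_induction_tmul with
    | zero => simp
    | add u u' hu hu' => simp only [map_add, inner_add_right, hu, hu']
    | mk c d c' d' => simp; ring

theorem swapSnd_isSymmetric : (swapSnd H₁ H₂).IsSymmetric := by
  intro u w
  induction u using tensorSquare_induction_tmul with
  | zero => simp
  | add u u' hu hu' => simp only [map_add, inner_add_left, hu, hu']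
  | mk a b a' b' =>
    induction w using tensorSquare_induction_tmul with
    | zero => simp
    | add u u' hu hu' => simp only [map_add, inner_add_right, hu, hu']
    | mk c d c' d' => simp; ring

theorem ketBra_tmul (a₁ b₁ : H₁) (a₂ b₂ : H₂) :
    ketBra (a₁ ⊗ₜ[ℂ] a₂) (b₁ ⊗ₜ[ℂ] b₂) = TensorProduct.map (ketBra a₁ b₁) (ketBra a₂ b₂) := by
  ext x y
  simp [TensorProduct.smul_tmul', TensorProduct.tmul_smul, smul_smul, mul_comm]

end Swap

/-! ### Partial traces expressed through partial swaps -/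

section PartialTrace

variable {H₁ H₂ : Type*} [NormedAddCommGroup H₁] [InnerProductSpace ℂ H₁]
  [FiniteDimensional ℂ H₁] [NormedAddCommGroup H₂] [InnerProductSpace ℂ H₂]
  [FiniteDimensional ℂ H₂]

/-- Both sides are additive in each of the four vectors, which reduces the identity to product
vectors, where each is the same product of four scalar inner products. -/
theorem hsInner_partialTrace₁_ketBra (a b a' b' : H₁ ⊗[ℂ] H₂) :
    hsInner (partialTrace₁ (ketBra a b)) (partialTrace₁ (ketBra a' b')) =
      inner ℂ (sqMk a b') (swapFst H₁ H₂ (sqMk a' b)) := by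
  induction a with
  | zero => simp
  | add x y hx hy =>
    simp only [ketBra_add_left, map_add, hsInner_add_left, LinearMap.add_apply,
      inner_add_left, hx, hy]
  | tmul a₁ a₂ =>
  induction a' with
  | zero => simp
  | add x y hx hy =>
    simp only [ketBra_add_left, map_add, hsInner_add_right, LinearMap.add_apply,
      inner_add_right, hx, hy]
  | tmul a₁' a₂' =>
  induction b with
  | zero => simp
  | add x y hx hy =>
    simp only [ketBra_add_right, map_add, hsInner_add_left,
      inner_add_right, hx, hy]
  | tmul b₁ b₂ =>
  induction b' with
  | zero => simp
  | add x y hx hy =>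
    simp only [ketBra_add_right, map_add, hsInner_add_right,
      inner_add_left, hx, hy]
  | tmul b₁' b₂' =>
    simp only [ketBra_tmul, partialTrace₁_map, trace_ketBra, hsInner_smul_left,
      hsInner_smul_right, hsInner_ketBra, swapFst_sqMk, inner_sqMk,
      TensorProduct.inner_tmul, inner_conj_symm]
    ring

theorem hsInner_partialTrace₂_ketBra (a b a' b' : H₁ ⊗[ℂ] H₂) :
    hsInner (partialTrace₂ (ketBra a b)) (partialTrace₂ (ketBra a' b')) =
      inner ℂ (sqMk a b') (swapSnd H₁ H₂ (sqMk a' b)) := by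
  induction a with
  | zero => simp
  | add x y hx hy =>
    simp only [ketBra_add_left, map_add, hsInner_add_left, LinearMap.add_apply,
      inner_add_left, hx, hy]
  | tmul a₁ a₂ =>
  induction a' with
  | zero => simp
  | add x y hx hy =>
    simp only [ketBra_add_left, map_add, hsInner_add_right, LinearMap.add_apply,
      inner_add_right, hx, hy]
  | tmul a₁' a₂' =>
  induction b with
  | zero => simp
  | add x y hx hy =>
    simp only [ketBra_add_right, map_add, hsInner_add_left,
      inner_add_right, hx, hy]
  | tmul b₁ b₂ =>
  induction b' with
  | zero => simp
  | add x y hx hy =>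
    simp only [ketBra_add_right, map_add, hsInner_add_right,
      inner_add_left, hx, hy]
  | tmul b₁' b₂' =>
    simp only [ketBra_tmul, partialTrace₂_map, trace_ketBra, hsInner_smul_left,
      hsInner_smul_right, hsInner_ketBra, swapSnd_sqMk, inner_sqMk,
      TensorProduct.inner_tmul, inner_conj_symm]
    ring

end PartialTrace

/-! ### The inequality for commuting involutions -/

section Involutions

variable {V : Type*} [NormedAddCommGroup V] [InnerProductSpace ℂ V]

/-- Expansion of ‖(1 + εF)(u - F₁w)‖² ≥ 0. Since (1 + εF)² = 2(1 + εF), the square is twice the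
quadratic form of 1 + εF at u - F₁w, and FF₁ = F₂ produces the second cross term. -/
theorem two_re_inner_involutions_le {F₁ F₂ F : V →ₗ[ℂ] V}
    (h₁ : F₁.IsSymmetric) (h₂ : F₂.IsSymmetric)
    (h₁₁ : ∀ u, F₁ (F₁ u) = u) (h₂₂ : ∀ u, F₂ (F₂ u) = u)
    (h₁₂ : ∀ u, F₁ (F₂ u) = F u) (h₂₁ : ∀ u, F₂ (F₁ u) = F u) {ε : ℝ} (hε : ε ^ 2 = 1) (u w : V) :
    2 * (inner ℂ u (F₁ w)).re + ε * (2 * (inner ℂ u (F₂ w)).re) ≤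
      ‖u‖ ^ 2 + ‖w‖ ^ 2 + ε * ((inner ℂ u (F u)).re + (inner ℂ w (F w)).re) := by
  have hF : F.IsSymmetric := fun x y => by
    rw [← h₁₂ x, ← h₂₁ y, h₁, h₂]
  have hFF : ∀ x, F (F x) = x := fun x => by rw [← h₁₂ x, ← h₂₁, h₁₁, h₂₂]
  have hFF₁ : ∀ x, F (F₁ x) = F₂ x := fun x => by rw [← h₂₁, h₁₁]
  set z := u - F₁ w with hz
  have hn : ∀ x : V, ‖x‖ ^ 2 = (inner ℂ x x).re := fun x => by
    rw [← inner_self_eq_norm_sq (𝕜 := ℂ) x]; rfl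
  have hre : ∀ x y : V, (inner ℂ x y).re = (inner ℂ y x).re := fun x y => inner_re_symm (𝕜 := ℂ) x y
  have key : 0 ≤ ‖z + (ε : ℂ) • F z‖ ^ 2 := sq_nonneg _
  have e1 : ‖z + (ε : ℂ) • F z‖ ^ 2 = 2 * (inner ℂ z z).re + 2 * ε * (inner ℂ z (F z)).re := by
    rw [hn]
    simp only [inner_add_left, inner_add_right, inner_smul_left, inner_smul_right,
      Complex.add_re, Complex.conj_ofReal, Complex.re_ofReal_mul]
    rw [hF z (F z), hFF, hre (F z) z]
    linear_combination (inner ℂ z z).re * hε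
  have e2 : (inner ℂ z z).re = ‖u‖ ^ 2 + ‖w‖ ^ 2 - 2 * (inner ℂ u (F₁ w)).re := by
    simp only [hz, inner_sub_left, inner_sub_right, Complex.sub_re, hn]
    rw [h₁ w (F₁ w), h₁₁, hre (F₁ w) u]
    ring
  have e3 : (inner ℂ z (F z)).re =
      (inner ℂ u (F u)).re + (inner ℂ w (F w)).re - 2 * (inner ℂ u (F₂ w)).re := by
    simp only [hz, map_sub, inner_sub_left, inner_sub_right, Complex.sub_re]
    rw [hFF₁, h₁ w (F u), h₁ w (F₂ w), h₁₂, ← h₁₂ u, h₁₁, ← h₂ w u, hre (F₂ w) u]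
    ring
  rw [e1, e2, e3] at key
  linarith

end Involutions

/-! ### Inequalities for a pair of rank-one terms -/

section PairInequalities

variable {H₁ H₂ : Type*} [NormedAddCommGroup H₁] [InnerProductSpace ℂ H₁]
  [NormedAddCommGroup H₂] [InnerProductSpace ℂ H₂]

theorem inner_tensor_smul_left (l : ℂ) (x y : H₁ ⊗[ℂ] H₂) :
    inner ℂ (l • x) y = (starRingEnd ℂ) l * inner ℂ x y :=
  inner_smul_left (𝕜 := ℂ) (E := H₁ ⊗[ℂ] H₂) x y l

theorem inner_tensor_smul_right (l : ℂ) (x y : H₁ ⊗[ℂ] H₂) :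
    inner ℂ x (l • y) = l * inner ℂ x y :=
  inner_smul_right (𝕜 := ℂ) (E := H₁ ⊗[ℂ] H₂) x y l

theorem norm_inner_tensor_symm (x y : H₁ ⊗[ℂ] H₂) : ‖(inner ℂ x y : ℂ)‖ = ‖(inner ℂ y x : ℂ)‖ :=
  norm_inner_symm (𝕜 := ℂ) x y

theorem norm_sqMk_sq {X : Type*} [NormedAddCommGroup X] [InnerProductSpace ℂ X] (x y : X) :
    ‖sqMk x y‖ ^ 2 = ‖x‖ ^ 2 * ‖y‖ ^ 2 := by
  rw [← mul_pow]
  congr 1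
  exact TensorProduct.norm_tmul x y

theorem re_inner_swapSq_sqMk {X : Type*} [NormedAddCommGroup X] [InnerProductSpace ℂ X] (x y : X) :
    (inner ℂ (sqMk x y) (swapSq (sqMk x y))).re = ‖(inner ℂ x y : ℂ)‖ ^ 2 := by
  rw [swapSq_sqMk, inner_sqMk, ← inner_conj_symm y x, RCLike.mul_conj]
  norm_cast

theorem two_re_inner_swap_le {ε : ℝ} (hε : ε ^ 2 = 1) (a b a' b' : H₁ ⊗[ℂ] H₂) :
    2 * (inner ℂ (sqMk a b') (swapFst H₁ H₂ (sqMk a' b))).re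
        + ε * (2 * (inner ℂ (sqMk a b') (swapSnd H₁ H₂ (sqMk a' b))).re) ≤
      ‖a‖ ^ 2 * ‖b'‖ ^ 2 + ‖a'‖ ^ 2 * ‖b‖ ^ 2 +
        ε * (‖(inner ℂ a b' : ℂ)‖ ^ 2 + ‖(inner ℂ a' b : ℂ)‖ ^ 2) := by
  have h := two_re_inner_involutions_le (swapFst_isSymmetric (H₁ := H₁) (H₂ := H₂))
    swapSnd_isSymmetric swapFst_swapFst swapSnd_swapSnd swapFst_swapSnd swapSnd_swapFst hε
    (sqMk a b') (sqMk a' b)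
  rwa [norm_sqMk_sq, norm_sqMk_sq, re_inner_swapSq_sqMk, re_inner_swapSq_sqMk] at h

/-- The real part of the form `⟨a ⊗ b', (F₁ + F₂) (a' ⊗ b)⟩` for the two partial swaps. -/
noncomputable def swapForm (a b' a' b : H₁ ⊗[ℂ] H₂) : ℝ :=
  (inner ℂ (sqMk a b') (swapFst H₁ H₂ (sqMk a' b))).re +
    (inner ℂ (sqMk a b') (swapSnd H₁ H₂ (sqMk a' b))).re

theorem swapForm_symm (a b' a' b : H₁ ⊗[ℂ] H₂) : swapForm a b' a' b = swapForm a' b a b' := by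
  unfold swapForm
  rw [← swapFst_isSymmetric, ← swapSnd_isSymmetric]
  congr 1
  · exact inner_re_symm (𝕜 := ℂ) _ _
  · exact inner_re_symm (𝕜 := ℂ) _ _

theorem swapFst_swapSq (u : TensorSquare (H₁ ⊗[ℂ] H₂)) :
    swapFst H₁ H₂ (swapSq u) = swapSnd H₁ H₂ u := by
  rw [← swapFst_swapSnd, swapFst_swapFst]

theorem swapSnd_swapSq (u : TensorSquare (H₁ ⊗[ℂ] H₂)) :
    swapSnd H₁ H₂ (swapSq u) = swapFst H₁ H₂ u := by
  rw [← swapSnd_swapFst, swapSnd_swapSnd]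

/-- Composing with the full swap F interchanges F₁ and F₂, so the two summands trade places. -/
theorem swapForm_comm_right (a b' a' b : H₁ ⊗[ℂ] H₂) : swapForm a b' a' b = swapForm a b' b a' := by
  unfold swapForm
  rw [← swapSq_sqMk a' b, swapFst_swapSq, swapSnd_swapSq, add_comm]

theorem swapForm_self_le (a b : H₁ ⊗[ℂ] H₂) :
    swapForm a b a b ≤ ‖a‖ ^ 2 * ‖b‖ ^ 2 + ‖(inner ℂ a b : ℂ)‖ ^ 2 := by
  have h := two_re_inner_swap_le (ε := 1) (by norm_num) a b a b
  unfold swapForm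
  linarith

/-- The value is ‖tr₁ |a⟩⟨b|‖₂² + ‖tr₂ |a⟩⟨b|‖₂². -/
theorem swapForm_self_nonneg [FiniteDimensional ℂ H₁] [FiniteDimensional ℂ H₂]
    (a b : H₁ ⊗[ℂ] H₂) : 0 ≤ swapForm a b a b := by
  have h₁ := hsInner_self_re_nonneg (partialTrace₁ (ketBra a b))
  have h₂ := hsInner_self_re_nonneg (partialTrace₂ (ketBra a b))
  rw [hsInner_partialTrace₁_ketBra] at h₁
  rw [hsInner_partialTrace₂_ketBra] at h₂
  exact add_nonneg h₁ h₂

theorem swapForm_add_add (v p q : H₁ ⊗[ℂ] H₂) :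
    swapForm v (p + q) v (p + q) =
      swapForm v p v p + swapForm v q v q + 2 * swapForm v p v q := by
  have h := swapForm_symm v q v p
  unfold swapForm at h ⊢
  simp only [map_add, inner_add_left, inner_add_right, Complex.add_re]
  linarith

theorem swapForm_sub_sub (v p q : H₁ ⊗[ℂ] H₂) :
    swapForm v (p - q) v (p - q) =
      swapForm v p v p + swapForm v q v q - 2 * swapForm v p v q := by
  have h := swapForm_symm v q v p
  unfold swapForm at h ⊢
  simp only [map_sub, inner_sub_left, inner_sub_right, Complex.sub_re]
  linarith

theorem swapForm_smul_eq (l : ℂ) (a b v : H₁ ⊗[ℂ] H₂) :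
    swapForm (l • v) b a v = swapForm v (l • b) v a := by
  rw [swapForm_comm_right]
  have h : ∀ x y : H₁ ⊗[ℂ] H₂, sqMk (l • x) y = sqMk x (l • y) := fun x y =>
    TensorProduct.smul_tmul l x y
  rw [swapForm, swapForm, h]

/-- If `v` is a unit vector orthogonal to `a` and to the unit vector `b`, the cross term of
`|a⟩⟨b|` and `l |v⟩⟨v|` is controlled with a gain measured by the difference of their traces. -/
theorem two_swapForm_le [FiniteDimensional ℂ H₁] [FiniteDimensional ℂ H₂]
    (l : ℂ) {a b v : H₁ ⊗[ℂ] H₂} (hv : ‖v‖ = 1) (hb : ‖b‖ = 1)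
    (hva : inner ℂ v a = 0) (hvb : inner ℂ v b = 0) :
    2 * swapForm (l • v) b a v ≤ ‖a‖ ^ 2 + ‖l‖ ^ 2 - ‖inner ℂ b a - l‖ ^ 2 / 2 := by
  -- The cross term is now the polarization of Q(p) = `swapForm v p v p` at l • b and a. Hence four
  -- times it equals Q(lb + a) - Q(lb - a) ≤ ‖lb + a‖², because Q ≥ 0 and v is orthogonal to lb + a.
  rw [swapForm_smul_eq]
  have h₁ := swapForm_self_le v (l • b + a)
  have h₂ := swapForm_self_nonneg v (l • b - a)
  rw [swapForm_add_add] at h₁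
  rw [swapForm_sub_sub] at h₂
  have h₃ : inner ℂ v (l • b + a) = 0 := by
    rw [inner_add_right, inner_tensor_smul_right, hva, hvb]; simp
  have h₄ : ‖l • b + a‖ ^ 2 = ‖l‖ ^ 2 + ‖a‖ ^ 2 + 2 * ((starRingEnd ℂ) l * inner ℂ b a).re := by
    rw [norm_add_sq (𝕜 := ℂ), norm_smul, hb, inner_tensor_smul_left]
    simp only [RCLike.re_to_complex]
    ring
  have h₅ : ‖inner ℂ b a - l‖ ^ 2 =
      ‖(inner ℂ b a : ℂ)‖ ^ 2 + ‖l‖ ^ 2 - 2 * ((starRingEnd ℂ) l * inner ℂ b a).re := by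
    simp only [← Complex.normSq_eq_norm_sq, Complex.normSq_apply, Complex.sub_re, Complex.sub_im,
      Complex.mul_re, Complex.conj_re, Complex.conj_im]
    ring
  have h₆ : ‖(inner ℂ b a : ℂ)‖ ^ 2 ≤ ‖a‖ ^ 2 := by
    have := norm_inner_le_norm (𝕜 := ℂ) b a
    rw [hb, one_mul] at this
    gcongr
  rw [h₃, h₄, hv] at h₁
  rw [h₅]
  simp only [norm_zero] at h₁
  -- The slack left over is (‖a‖² - |⟨b, a⟩|²)/2, nonnegative by `h₆`.
  nlinarith [sq_nonneg ‖l‖]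

end PairInequalities

/-! ### Summation over pairs of rank-one terms -/

section RankOneSums

variable {ι : Type*} [Fintype ι]

theorem sum_sum_norm_sub_sq (z : ι → ℂ) :
    ∑ l, ∑ k, ‖z k - z l‖ ^ 2 =
      2 * Fintype.card ι * ∑ k, ‖z k‖ ^ 2 - 2 * ‖∑ k, z k‖ ^ 2 := by
  have h : ∀ l k, ‖z k - z l‖ ^ 2 =
      ‖z k‖ ^ 2 + ‖z l‖ ^ 2 - 2 * ((z k).re * (z l).re) - 2 * ((z k).im * (z l).im) := fun l k => by
    simp only [← Complex.normSq_eq_norm_sq, Complex.normSq_apply, Complex.sub_re, Complex.sub_im]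
    ring
  have hs : ‖∑ k, z k‖ ^ 2 = (∑ l, ∑ k, (z k).re * (z l).re) + ∑ l, ∑ k, (z k).im * (z l).im := by
    rw [← Complex.normSq_eq_norm_sq, Complex.normSq_apply, Complex.re_sum, Complex.im_sum]
    simp only [← Finset.sum_mul, ← Finset.mul_sum]
  simp only [h, Finset.sum_sub_distrib, Finset.sum_add_distrib, ← Finset.mul_sum, hs]
  simp only [Finset.sum_const, Finset.card_univ, nsmul_eq_mul, ← Finset.mul_sum]
  ring

theorem sum_sum_add_eq (f : ι → ℝ) :
    ∑ l, ∑ k, (f l + f k) = 2 * (Fintype.card ι * ∑ k, f k) := by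
  simp only [Finset.sum_add_distrib, Finset.sum_const, Finset.card_univ, nsmul_eq_mul,
    ← Finset.mul_sum]
  ring

theorem one_div_card_mul_norm_sum_sq_le (z : ι → ℂ) :
    1 / (Fintype.card ι : ℝ) * ‖∑ k, z k‖ ^ 2 ≤ ∑ k, ‖z k‖ ^ 2 := by
  rcases isEmpty_or_nonempty ι with h | h
  · simp
  · have hn : (0 : ℝ) < Fintype.card ι := by exact_mod_cast Fintype.card_pos
    rw [one_div, inv_mul_le_iff₀ hn]
    calc ‖∑ k, z k‖ ^ 2 ≤ (∑ k, ‖z k‖) ^ 2 := by gcongr; exact norm_sum_le _ _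
      _ ≤ _ := sq_sum_le_card_mul_sum_sq

theorem hsNorm_sq_sum_ketBra {H : Type*} [NormedAddCommGroup H] [InnerProductSpace ℂ H]
    [FiniteDimensional ℂ H] {a b : ι → H} (hb : Orthonormal ℂ b) :
    hsNorm (∑ k, ketBra (a k) (b k)) ^ 2 = ∑ k, ‖a k‖ ^ 2 := by
  classical
  rw [hsNorm_sq]
  simp only [hsInner_sum_left, hsInner_sum_right, hsInner_ketBra, orthonormal_iff_ite.1 hb,
    mul_ite, mul_one, mul_zero, Finset.mem_univ, if_true, Complex.re_sum,
    Finset.sum_ite_eq]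
  refine Finset.sum_congr rfl fun k _ => ?_
  rw [← inner_self_eq_norm_sq (𝕜 := ℂ) (a k)]; rfl

theorem trace_sum_ketBra {H : Type*} [NormedAddCommGroup H] [InnerProductSpace ℂ H]
    [FiniteDimensional ℂ H] (a b : ι → H) :
    LinearMap.trace ℂ H (∑ k, ketBra (a k) (b k)) = ∑ k, inner ℂ (b k) (a k) := by
  simp

variable {H₁ H₂ : Type*} [NormedAddCommGroup H₁] [InnerProductSpace ℂ H₁]
  [FiniteDimensional ℂ H₁] [NormedAddCommGroup H₂] [InnerProductSpace ℂ H₂]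
  [FiniteDimensional ℂ H₂]

theorem trace_sum_ketBra_tensor (a b : ι → H₁ ⊗[ℂ] H₂) :
    LinearMap.trace ℂ (H₁ ⊗[ℂ] H₂) (∑ k, ketBra (a k) (b k)) = ∑ k, inner ℂ (b k) (a k) :=
  trace_sum_ketBra a b

theorem hsNorm_sq_partialTrace₁_sum_ketBra (a b : ι → H₁ ⊗[ℂ] H₂) :
    hsNorm (partialTrace₁ (∑ k, ketBra (a k) (b k))) ^ 2 =
      ∑ l, ∑ k, (inner ℂ (sqMk (a l) (b k)) (swapFst H₁ H₂ (sqMk (a k) (b l)))).re := by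
  rw [hsNorm_sq]
  simp only [map_sum, hsInner_sum_left, hsInner_sum_right, hsInner_partialTrace₁_ketBra,
    Complex.re_sum]
  exact Finset.sum_comm

theorem hsNorm_sq_partialTrace₂_sum_ketBra (a b : ι → H₁ ⊗[ℂ] H₂) :
    hsNorm (partialTrace₂ (∑ k, ketBra (a k) (b k))) ^ 2 =
      ∑ l, ∑ k, (inner ℂ (sqMk (a l) (b k)) (swapSnd H₁ H₂ (sqMk (a k) (b l)))).re := by
  rw [hsNorm_sq]
  simp only [map_sum, hsInner_sum_left, hsInner_sum_right, hsInner_partialTrace₂_ketBra,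
    Complex.re_sum]
  exact Finset.sum_comm

/-- The pair inequality with ε = -1 leaves the negative terms -|⟨a_l, b_k⟩|². Only those with l = k
are kept, and Cauchy-Schwarz converts them into the trace term. -/
theorem abs_hsNorm_sq_partialTrace_sub_le_of_orthonormal (a : ι → H₁ ⊗[ℂ] H₂)
    {b : ι → H₁ ⊗[ℂ] H₂} (hb : Orthonormal ℂ b) :
    |hsNorm (partialTrace₁ (∑ k, ketBra (a k) (b k))) ^ 2 -
        hsNorm (partialTrace₂ (∑ k, ketBra (a k) (b k))) ^ 2| ≤
      Fintype.card ι * ∑ k, ‖a k‖ ^ 2 - 1 / (Fintype.card ι : ℝ) * ‖∑ k, inner ℂ (b k) (a k)‖ ^ 2 := by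
  set D : ι → ι → ℝ := fun l k =>
    (inner ℂ (sqMk (a l) (b k)) (swapFst H₁ H₂ (sqMk (a k) (b l)))).re -
      (inner ℂ (sqMk (a l) (b k)) (swapSnd H₁ H₂ (sqMk (a k) (b l)))).re with hD
  have hpair : ∀ l k, 2 * |D l k| ≤ (‖a l‖ ^ 2 + ‖a k‖ ^ 2) -
      (‖(inner ℂ (a l) (b k) : ℂ)‖ ^ 2 + ‖(inner ℂ (a k) (b l) : ℂ)‖ ^ 2) := fun l k => by
    have h₁ := two_re_inner_swap_le (ε := -1) (by norm_num) (a l) (b l) (a k) (b k)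
    -- Negating a_k flips the sign of both cross terms and leaves the bound unchanged, which
    -- supplies the absolute value.
    have h₂ := two_re_inner_swap_le (ε := -1) (by norm_num) (a l) (b l) (-a k) (b k)
    simp only [map_neg, LinearMap.neg_apply, inner_neg_left, inner_neg_right, norm_neg,
      Complex.neg_re, hb.1, one_pow, mul_one] at h₁ h₂
    simp only [hD]
    rcases abs_cases ((inner ℂ (sqMk (a l) (b k)) (swapFst H₁ H₂ (sqMk (a k) (b l)))).re -
      (inner ℂ (sqMk (a l) (b k)) (swapSnd H₁ H₂ (sqMk (a k) (b l)))).re) with h | h <;>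
    · rw [h.1]; linarith
  have hoff : ∑ k, ‖(inner ℂ (b k) (a k) : ℂ)‖ ^ 2 ≤
      ∑ l, ∑ k, ‖(inner ℂ (a l) (b k) : ℂ)‖ ^ 2 := by
    refine Finset.sum_le_sum fun k _ => ?_
    rw [norm_inner_tensor_symm]
    exact Finset.single_le_sum (f := fun j => ‖(inner ℂ (a k) (b j) : ℂ)‖ ^ 2)
      (fun _ _ => sq_nonneg _) (Finset.mem_univ k)
  have htr := one_div_card_mul_norm_sum_sq_le fun k => (inner ℂ (b k) (a k) : ℂ)
  have hsum : 2 * ∑ l, ∑ k, |D l k| ≤ 2 * (Fintype.card ι * ∑ k, ‖a k‖ ^ 2) -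
      2 * ∑ l, ∑ k, ‖(inner ℂ (a l) (b k) : ℂ)‖ ^ 2 := by
    have h := Finset.sum_le_sum fun l (_ : l ∈ Finset.univ) =>
      Finset.sum_le_sum fun k (_ : k ∈ Finset.univ) => hpair l k
    simp only [Finset.sum_sub_distrib, ← Finset.mul_sum] at h
    rw [sum_sum_add_eq fun k => ‖a k‖ ^ 2] at h
    have hc := Finset.sum_comm (s := Finset.univ) (t := Finset.univ)
      (f := fun l k => ‖(inner ℂ (a k) (b l) : ℂ)‖ ^ 2)
    simp only [Finset.sum_add_distrib] at h
    linarith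
  have habs : |∑ l, ∑ k, D l k| ≤ ∑ l, ∑ k, |D l k| :=
    (Finset.abs_sum_le_sum_abs _ _).trans
      (Finset.sum_le_sum fun _ _ => Finset.abs_sum_le_sum_abs _ _)
  rw [hsNorm_sq_partialTrace₁_sum_ketBra, hsNorm_sq_partialTrace₂_sum_ketBra]
  simp only [← Finset.sum_sub_distrib]
  linarith

/-- Diagonal pairs cost an extra |z_k|². The gains of the off-diagonal pairs, weakened to weight 1/n
for n terms, pay for it exactly through ∑ |z_k - z_l|² = 2n ∑ |z_k|² - 2 |∑ z_k|². -/
theorem hsNorm_sq_partialTrace_add_le_of_pairwise {a b : ι → H₁ ⊗[ℂ] H₂} (hb : ∀ k, ‖b k‖ = 1)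
    (hpair : ∀ l k, l ≠ k → 2 * swapForm (a l) (b k) (a k) (b l) ≤
      ‖a l‖ ^ 2 + ‖a k‖ ^ 2 - ‖inner ℂ (b k) (a k) - inner ℂ (b l) (a l)‖ ^ 2 / 2) :
    hsNorm (partialTrace₁ (∑ k, ketBra (a k) (b k))) ^ 2 +
        hsNorm (partialTrace₂ (∑ k, ketBra (a k) (b k))) ^ 2 ≤
      Fintype.card ι * ∑ k, ‖a k‖ ^ 2 + 1 / (Fintype.card ι : ℝ) * ‖∑ k, inner ℂ (b k) (a k)‖ ^ 2 := by
  classical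
  rcases isEmpty_or_nonempty ι with h | h
  · simp [hsNorm]
  have hn : (0 : ℝ) < Fintype.card ι := by exact_mod_cast Fintype.card_pos
  set z : ι → ℂ := fun k => inner ℂ (b k) (a k) with hz
  have hall : ∀ l k, 2 * swapForm (a l) (b k) (a k) (b l) ≤
      (‖a l‖ ^ 2 + ‖a k‖ ^ 2) - 1 / (Fintype.card ι : ℝ) * ‖z k - z l‖ ^ 2 +
        2 * (if l = k then ‖z k‖ ^ 2 else 0) := fun l k => by
    by_cases hlk : l = k
    · subst hlk
      have h := swapForm_self_le (a l) (b l)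
      rw [hb, norm_inner_tensor_symm] at h
      simp only [sub_self, norm_zero, if_true, hz]
      linarith
    -- Two distinct indices force n ≥ 2, so the available gain 1/2 dominates the required 1/n.
    · have h2 : (2 : ℝ) ≤ Fintype.card ι := by
        exact_mod_cast Fintype.one_lt_card_iff.2 ⟨l, k, hlk⟩
      have h3 : 1 / (Fintype.card ι : ℝ) ≤ 1 / 2 := one_div_le_one_div_of_le two_pos h2
      have h4 := mul_le_mul_of_nonneg_right h3 (sq_nonneg ‖z k - z l‖)
      have h5 := hpair l k hlk
      simp only [if_neg hlk]
      simp only [hz] at h4 ⊢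
      linarith
  have hsum := Finset.sum_le_sum fun l (_ : l ∈ Finset.univ) =>
    Finset.sum_le_sum fun k (_ : k ∈ Finset.univ) => hall l k
  have hadd := sum_sum_add_eq fun k => ‖a k‖ ^ 2
  have hsub := sum_sum_norm_sub_sq z
  rw [Finset.sum_congr rfl fun l _ => Finset.sum_add_distrib, Finset.sum_add_distrib] at hsum
  simp only [Finset.sum_sub_distrib, ← Finset.mul_sum, Finset.sum_ite_eq,
    Finset.mem_univ, if_true] at hsum
  rw [hadd, hsub] at hsum
  have hcancel : 1 / (Fintype.card ι : ℝ) *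
      (2 * Fintype.card ι * ∑ k, ‖z k‖ ^ 2 - 2 * ‖∑ k, z k‖ ^ 2) =
      2 * ∑ k, ‖z k‖ ^ 2 - 2 * (1 / (Fintype.card ι : ℝ) * ‖∑ k, z k‖ ^ 2) := by
    field_simp
  rw [hcancel] at hsum
  rw [hsNorm_sq_partialTrace₁_sum_ketBra, hsNorm_sq_partialTrace₂_sum_ketBra]
  simp only [← Finset.sum_add_distrib]
  unfold swapForm at hsum
  linarith

end RankOneSums

/-! ### Partial traces as Hilbert-Schmidt adjoints -/

section DimensionBound

variable {H₁ H₂ : Type*} [NormedAddCommGroup H₁] [InnerProductSpace ℂ H₁]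
  [FiniteDimensional ℂ H₁] [NormedAddCommGroup H₂] [InnerProductSpace ℂ H₂]
  [FiniteDimensional ℂ H₂]

/-- In finite dimension the operators A ⊗ B span all operators on H₁ ⊗ H₂. -/
theorem tensorEnd_induction {P : (H₁ ⊗[ℂ] H₂ →ₗ[ℂ] H₁ ⊗[ℂ] H₂) → Prop} (zero : P 0)
    (map : ∀ A B, P (TensorProduct.map A B)) (add : ∀ C D, P C → P D → P (C + D))
    (C : H₁ ⊗[ℂ] H₂ →ₗ[ℂ] H₁ ⊗[ℂ] H₂) : P C := by
  obtain ⟨z, rfl⟩ := (homTensorHomEquiv ℂ H₁ H₂ H₁ H₂).surjective C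
  induction z with
  | zero => rw [map_zero]; exact zero
  | add z w hz hw => rw [map_add]; exact add _ _ hz hw
  | tmul A B => simpa using map A B

theorem adjoint_tensorMap (A : H₁ →ₗ[ℂ] H₁) (B : H₂ →ₗ[ℂ] H₂) :
    LinearMap.adjoint (TensorProduct.map A B) =
      TensorProduct.map (LinearMap.adjoint A) (LinearMap.adjoint B) :=
  TensorProduct.adjoint_map A B

theorem hsInner_map_map (A A' : H₁ →ₗ[ℂ] H₁) (B B' : H₂ →ₗ[ℂ] H₂) :
    hsInner (TensorProduct.map A B) (TensorProduct.map A' B') = hsInner A A' * hsInner B B' := by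
  rw [hsInner, adjoint_tensorMap, ← TensorProduct.map_comp]
  exact LinearMap.trace_tensorProduct' _ _

/-- This duality makes every inner product between C and the operators 1 ⊗ T computable from tr₁ C.
-/
theorem hsInner_map_id_left (T : H₂ →ₗ[ℂ] H₂) (C : H₁ ⊗[ℂ] H₂ →ₗ[ℂ] H₁ ⊗[ℂ] H₂) :
    hsInner (TensorProduct.map LinearMap.id T) C = hsInner T (partialTrace₁ C) := by
  induction C using tensorEnd_induction with
  | zero => simp
  | map A B => rw [hsInner_map_map, partialTrace₁_map, hsInner_smul_right, hsInner_id_left]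
  | add C D hC hD => rw [map_add, hsInner_add_right, hsInner_add_right, hC, hD]

theorem hsInner_map_id_right (T : H₁ →ₗ[ℂ] H₁) (C : H₁ ⊗[ℂ] H₂ →ₗ[ℂ] H₁ ⊗[ℂ] H₂) :
    hsInner (TensorProduct.map T LinearMap.id) C = hsInner T (partialTrace₂ C) := by
  induction C using tensorEnd_induction with
  | zero => simp
  | map A B => rw [hsInner_map_map, partialTrace₂_map, hsInner_smul_right, hsInner_id_left, mul_comm]
  | add C D hC hD => rw [map_add, hsInner_add_right, hsInner_add_right, hC, hD]

theorem trace_partialTrace₁ (C : H₁ ⊗[ℂ] H₂ →ₗ[ℂ] H₁ ⊗[ℂ] H₂) :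
    LinearMap.trace ℂ H₂ (partialTrace₁ C) = LinearMap.trace ℂ (H₁ ⊗[ℂ] H₂) C := by
  induction C using tensorEnd_induction with
  | zero => simp
  | map A B => rw [partialTrace₁_map, LinearMap.trace_tensorProduct', map_smul, smul_eq_mul]
  | add C D hC hD => simp only [map_add, hC, hD]

theorem trace_partialTrace₂ (C : H₁ ⊗[ℂ] H₂ →ₗ[ℂ] H₁ ⊗[ℂ] H₂) :
    LinearMap.trace ℂ H₁ (partialTrace₂ C) = LinearMap.trace ℂ (H₁ ⊗[ℂ] H₂) C := by
  induction C using tensorEnd_induction with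
  | zero => simp
  | map A B =>
    rw [partialTrace₂_map, LinearMap.trace_tensorProduct', map_smul, smul_eq_mul, mul_comm]
  | add C D hC hD => simp only [map_add, hC, hD]

end DimensionBound

/-! ### Bounds in terms of the dimensions -/

section TraceBounds

variable {H : Type*} [NormedAddCommGroup H] [InnerProductSpace ℂ H] [FiniteDimensional ℂ H]

theorem hsInner_self (T : H →ₗ[ℂ] H) : hsInner T T = ((hsNorm T ^ 2 : ℝ) : ℂ) := by
  rw [hsNorm_sq]
  exact (Complex.conj_eq_iff_re.1 (hsInner_conj_symm T T)).symm

@[simp] theorem hsInner_id_right (T : H →ₗ[ℂ] H) :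
    hsInner T LinearMap.id = (starRingEnd ℂ) (LinearMap.trace ℂ H T) := by
  rw [← hsInner_conj_symm, hsInner_id_left]

/-- Cauchy-Schwarz against the identity, obtained from ‖nT - (tr T) 1‖₂² ≥ 0. -/
theorem norm_trace_sq_le (T : H →ₗ[ℂ] H) :
    ‖LinearMap.trace ℂ H T‖ ^ 2 ≤ Module.finrank ℂ H * hsNorm T ^ 2 := by
  rcases Nat.eq_zero_or_pos (Module.finrank ℂ H) with h | h
  · have := Module.finrank_zero_iff.1 h
    have hT : T = 0 := Subsingleton.elim _ _
    simp [hT, h]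
  · set n : ℝ := (Module.finrank ℂ H : ℝ) with hn
    have hpos : 0 < n := by rw [hn]; exact_mod_cast h
    set τ := LinearMap.trace ℂ H T with hτ
    have key := hsInner_self_re_nonneg ((n : ℂ) • T - τ • LinearMap.id)
    have hid : LinearMap.trace ℂ H LinearMap.id = (n : ℂ) := by
      rw [LinearMap.trace_id, hn]; norm_cast
    have e : hsInner ((n : ℂ) • T - τ • LinearMap.id) ((n : ℂ) • T - τ • LinearMap.id) =
        ((n * (n * hsNorm T ^ 2 - ‖τ‖ ^ 2) : ℝ) : ℂ) := by
      simp only [hsInner_sub_left, hsInner_sub_right, hsInner_smul_left, hsInner_smul_right,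
        Complex.conj_ofReal]
      simp only [hsInner_id_left, hsInner_id_right, hid, hsInner_self T, ← hτ, Complex.conj_ofReal]
      have hz := Complex.mul_conj' τ
      push_cast
      linear_combination (-(n : ℂ)) * hz
    rw [e, Complex.ofReal_re] at key
    have := nonneg_of_mul_nonneg_right key hpos
    linarith

variable {H₁ H₂ : Type*} [NormedAddCommGroup H₁] [InnerProductSpace ℂ H₁]
  [FiniteDimensional ℂ H₁] [NormedAddCommGroup H₂] [InnerProductSpace ℂ H₂]
  [FiniteDimensional ℂ H₂]

theorem hsNorm_sq_partialTrace_div_add_le (C : H₁ ⊗[ℂ] H₂ →ₗ[ℂ] H₁ ⊗[ℂ] H₂)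
    {m n : ℝ} (hm : m = Module.finrank ℂ H₁) (hn : n = Module.finrank ℂ H₂)
    (hm0 : 0 < m) (hn0 : 0 < n) :
    n * hsNorm (partialTrace₁ C) ^ 2 + m * hsNorm (partialTrace₂ C) ^ 2 ≤
      m * n * hsNorm C ^ 2 + ‖LinearMap.trace ℂ (H₁ ⊗[ℂ] H₂) C‖ ^ 2 := by
  set τ := LinearMap.trace ℂ (H₁ ⊗[ℂ] H₂) C with hτ
  set S := TensorProduct.map (LinearMap.id : H₁ →ₗ[ℂ] H₁) (partialTrace₁ C) with hS
  set R := TensorProduct.map (partialTrace₂ C) (LinearMap.id : H₂ →ₗ[ℂ] H₂) with hR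
  set I : H₁ ⊗[ℂ] H₂ →ₗ[ℂ] H₁ ⊗[ℂ] H₂ := LinearMap.id with hI
  have hid₁ : LinearMap.trace ℂ H₁ LinearMap.id = (m : ℂ) := by
    rw [LinearMap.trace_id, hm]; norm_cast
  have hid₂ : LinearMap.trace ℂ H₂ LinearMap.id = (n : ℂ) := by
    rw [LinearMap.trace_id, hn]; norm_cast
  have hIm : I = TensorProduct.map LinearMap.id LinearMap.id := TensorProduct.map_id.symm
  have hSC : hsInner S C = ((hsNorm (partialTrace₁ C) ^ 2 : ℝ) : ℂ) := by
    rw [hS, hsInner_map_id_left, hsInner_self]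
  have hRC : hsInner R C = ((hsNorm (partialTrace₂ C) ^ 2 : ℝ) : ℂ) := by
    rw [hR, hsInner_map_id_right, hsInner_self]
  have hCS : hsInner C S = ((hsNorm (partialTrace₁ C) ^ 2 : ℝ) : ℂ) := by
    rw [← hsInner_conj_symm, hSC, Complex.conj_ofReal]
  have hCR : hsInner C R = ((hsNorm (partialTrace₂ C) ^ 2 : ℝ) : ℂ) := by
    rw [← hsInner_conj_symm, hRC, Complex.conj_ofReal]
  have hSS : hsInner S S = m * ((hsNorm (partialTrace₁ C) ^ 2 : ℝ) : ℂ) := by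
    rw [hS, hsInner_map_map, hsInner_id_left, hid₁, hsInner_self]
  have hRR : hsInner R R = ((hsNorm (partialTrace₂ C) ^ 2 : ℝ) : ℂ) * n := by
    rw [hR, hsInner_map_map, hsInner_id_left, hid₂, hsInner_self]
  have hz := Complex.mul_conj' τ
  have hSR : hsInner S R = τ * (starRingEnd ℂ) τ := by
    rw [hS, hR, hsInner_map_map, hsInner_id_left, hsInner_id_right, trace_partialTrace₁,
      trace_partialTrace₂]
  have hRS : hsInner R S = τ * (starRingEnd ℂ) τ := by
    rw [hS, hR, hsInner_map_map, hsInner_id_left, hsInner_id_right, trace_partialTrace₁,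
      trace_partialTrace₂, mul_comm]
  have hSI : hsInner S I = m * (starRingEnd ℂ) τ := by
    rw [hS, hIm, hsInner_map_map, hsInner_id_left, hsInner_id_right, trace_partialTrace₁, hid₁]
  have hRI : hsInner R I = (starRingEnd ℂ) τ * n := by
    rw [hR, hIm, hsInner_map_map, hsInner_id_left, hsInner_id_right, trace_partialTrace₂, hid₂]
  have hIS : hsInner I S = m * τ := by
    rw [hS, hIm, hsInner_map_map, hsInner_id_left, hsInner_id_left, trace_partialTrace₁, hid₁]
  have hIR : hsInner I R = τ * n := by
    rw [hR, hIm, hsInner_map_map, hsInner_id_left, hsInner_id_left, trace_partialTrace₂, hid₂]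
  have hII : hsInner I I = m * n := by
    rw [hIm, hsInner_map_map, hsInner_id_left, hsInner_id_left, hid₁, hid₂]
  have hIC : hsInner I C = τ := hsInner_id_left C
  have hCI : hsInner C I = (starRingEnd ℂ) τ := hsInner_id_right C
  -- This operator is mn times the component of C orthogonal to all 1 ⊗ T and T ⊗ 1. The projection
  -- is S/m + R/n - τI/(mn), the last term correcting for the multiples of the identity counted
  -- twice.
  have key := hsInner_self_re_nonneg
    (((m * n : ℝ) : ℂ) • C - (n : ℂ) • S - (m : ℂ) • R + τ • I)
  have e : hsInner (((m * n : ℝ) : ℂ) • C - (n : ℂ) • S - (m : ℂ) • R + τ • I)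
      (((m * n : ℝ) : ℂ) • C - (n : ℂ) • S - (m : ℂ) • R + τ • I) =
      (((m * n) * (m * n * hsNorm C ^ 2 + ‖τ‖ ^ 2 - n * hsNorm (partialTrace₁ C) ^ 2
        - m * hsNorm (partialTrace₂ C) ^ 2) : ℝ) : ℂ) := by
    simp only [hsInner_sub_left, hsInner_sub_right, hsInner_add_left, hsInner_add_right,
      hsInner_smul_left, hsInner_smul_right, hsInner_self C, hSC, hRC, hCS, hCR, hSS, hRR, hSR, hRS,
      hSI, hRI, hIS, hIR, hII, hIC, hCI, Complex.conj_ofReal]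
    push_cast
    linear_combination ((m : ℂ) * n) * hz
  rw [e, Complex.ofReal_re] at key
  have := nonneg_of_mul_nonneg_right key (mul_pos hm0 hn0)
  linarith

theorem norm_trace_sq_le_partialTrace₁ (C : H₁ ⊗[ℂ] H₂ →ₗ[ℂ] H₁ ⊗[ℂ] H₂) :
    ‖LinearMap.trace ℂ (H₁ ⊗[ℂ] H₂) C‖ ^ 2 ≤
      Module.finrank ℂ H₂ * hsNorm (partialTrace₁ C) ^ 2 := by
  rw [← trace_partialTrace₁]
  exact norm_trace_sq_le _

theorem norm_trace_sq_le_partialTrace₂ (C : H₁ ⊗[ℂ] H₂ →ₗ[ℂ] H₁ ⊗[ℂ] H₂) :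
    ‖LinearMap.trace ℂ (H₁ ⊗[ℂ] H₂) C‖ ^ 2 ≤
      Module.finrank ℂ H₁ * hsNorm (partialTrace₂ C) ^ 2 := by
  rw [← trace_partialTrace₂]
  exact norm_trace_sq_le _

theorem partialTrace_dimension_bounds (C : H₁ ⊗[ℂ] H₂ →ₗ[ℂ] H₁ ⊗[ℂ] H₂) {d : ℕ}
    (hd : d = max (Module.finrank ℂ H₁) (Module.finrank ℂ H₂)) :
    |hsNorm (partialTrace₁ C) ^ 2 - hsNorm (partialTrace₂ C) ^ 2| ≤
        (d : ℝ) * hsNorm C ^ 2 - 1 / (d : ℝ) * ‖LinearMap.trace ℂ (H₁ ⊗[ℂ] H₂) C‖ ^ 2 ∧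
    hsNorm (partialTrace₁ C) ^ 2 + hsNorm (partialTrace₂ C) ^ 2 ≤
        (d : ℝ) * hsNorm C ^ 2 + 1 / (d : ℝ) * ‖LinearMap.trace ℂ (H₁ ⊗[ℂ] H₂) C‖ ^ 2 := by
  by_cases h0 : Module.finrank ℂ H₁ = 0 ∨ Module.finrank ℂ H₂ = 0
  · have hC : C = 0 := by
      have : Module.finrank ℂ (H₁ ⊗[ℂ] H₂) = 0 := by
        rw [Module.finrank_tensorProduct]
        exact mul_eq_zero.2 h0
      have := Module.finrank_zero_iff.1 this
      ext
      exact Subsingleton.elim _ _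
    subst hC
    simp [hsNorm]
  · push Not at h0
    have h₁ := norm_trace_sq_le_partialTrace₁ C
    have h₂ := norm_trace_sq_le_partialTrace₂ C
    have hm0 : (0 : ℝ) < Module.finrank ℂ H₁ := by exact_mod_cast Nat.pos_of_ne_zero h0.1
    have hn0 : (0 : ℝ) < Module.finrank ℂ H₂ := by exact_mod_cast Nat.pos_of_ne_zero h0.2
    have h := hsNorm_sq_partialTrace_div_add_le C rfl rfl hm0 hn0
    have hdm : (Module.finrank ℂ H₁ : ℝ) ≤ d := by rw [hd]; exact_mod_cast le_max_left _ _
    have hdn : (Module.finrank ℂ H₂ : ℝ) ≤ d := by rw [hd]; exact_mod_cast le_max_right _ _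
    have hdc : (d : ℝ) = Module.finrank ℂ H₁ ∨ (d : ℝ) = Module.finrank ℂ H₂ := by
      rcases max_choice (Module.finrank ℂ H₁) (Module.finrank ℂ H₂) with h | h
      · left; rw [hd, h]
      · right; rw [hd, h]
    have hx : 0 ≤ hsNorm (partialTrace₁ C) ^ 2 := sq_nonneg _
    have hy : 0 ≤ hsNorm (partialTrace₂ C) ^ 2 := sq_nonneg _
    have hc : 0 ≤ hsNorm C ^ 2 := sq_nonneg _
    generalize (Module.finrank ℂ H₁ : ℝ) = m at *
    generalize (Module.finrank ℂ H₂ : ℝ) = n at *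
    generalize (d : ℝ) = d at *
    generalize hsNorm (partialTrace₁ C) ^ 2 = x at *
    generalize hsNorm (partialTrace₂ C) ^ 2 = y at *
    generalize hsNorm C ^ 2 = c at *
    generalize ‖LinearMap.trace ℂ (H₁ ⊗[ℂ] H₂) C‖ ^ 2 = t at *
    have hd0 : 0 < d := hm0.trans_le hdm
    have htx : 1 / d * t ≤ x := by
      rw [one_div, inv_mul_le_iff₀ hd0]
      exact h₁.trans (mul_le_mul_of_nonneg_right hdn hx)
    have hty : 1 / d * t ≤ y := by
      rw [one_div, inv_mul_le_iff₀ hd0]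
      exact h₂.trans (mul_le_mul_of_nonneg_right hdm hy)
    -- In nx + my ≤ mnc + t, the bound t ≤ my absorbs the trace term.
    have hxc : x ≤ m * c := by
      have : n * x ≤ n * (m * c) := by linarith
      exact le_of_mul_le_mul_left this hn0
    have hyc : y ≤ n * c := by
      have : m * y ≤ m * (n * c) := by linarith
      exact le_of_mul_le_mul_left this hm0
    have hmd := mul_le_mul_of_nonneg_right hdm hc
    have hnd := mul_le_mul_of_nonneg_right hdn hc
    refine ⟨abs_le.2 ⟨by linarith, by linarith⟩, ?_⟩
    rcases hdc with rfl | rfl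
    · have h3 : n * (x + y) ≤ n * (d * c + 1 / d * t) := by
        -- Here d = m, so `h` carries dy where the goal has ny; the surplus (d - n)y is at least (d
        -- - n)t/d, leaving exactly nt/d of the trace term.
        have : 0 ≤ (d - n) * (y - 1 / d * t) := mul_nonneg (by linarith) (by linarith)
        have e : 1 / d * t * d = t := by field_simp
        nlinarith
      exact le_of_mul_le_mul_left h3 hn0
    · have h3 : m * (x + y) ≤ m * (d * c + 1 / d * t) := by
        have : 0 ≤ (d - m) * (x - 1 / d * t) := mul_nonneg (by linarith) (by linarith)
        have e : 1 / d * t * d = t := by field_simp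
        nlinarith
      exact le_of_mul_le_mul_left h3 hm0

end TraceBounds

/-! ### Decompositions into rank-one operators -/

section Decompositions

variable {H : Type*} [NormedAddCommGroup H] [InnerProductSpace ℂ H]

theorem finrank_range_sum_ketBra {ι : Type*} [Fintype ι] {a b : ι → H} (hb : Orthonormal ℂ b)
    (ha : LinearIndependent ℂ a) :
    Module.finrank ℂ (LinearMap.range (∑ k, ketBra (a k) (b k))) = Fintype.card ι := by
  classical
  have h : LinearMap.range (∑ k, ketBra (a k) (b k)) = Submodule.span ℂ (Set.range a) := by
    apply le_antisymm
    · rintro _ ⟨z, rfl⟩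
      simp only [LinearMap.sum_apply, ketBra_apply]
      exact Submodule.sum_mem _ fun k _ => Submodule.smul_mem _ _ (Submodule.subset_span ⟨k, rfl⟩)
    · rw [Submodule.span_le]
      rintro _ ⟨k, rfl⟩
      refine ⟨b k, ?_⟩
      simp [orthonormal_iff_ite.1 hb]
  rw [h, finrank_span_eq_card ha]

variable [FiniteDimensional ℂ H]

/-- Every operator of rank `n` is a sum of `n` rank-one operators with orthonormal bras. -/
theorem exists_orthonormal_eq_sum_ketBra (C : H →ₗ[ℂ] H) {n : ℕ}
    (hn : Module.finrank ℂ (LinearMap.range C) = n) :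
    ∃ b : Fin n → H, Orthonormal ℂ b ∧ C = ∑ k, ketBra (C (b k)) (b k) := by
  -- The bras are an orthonormal basis of (ker C)ᗮ, whose dimension is the rank.
  have hK : Module.finrank ℂ (LinearMap.ker C)ᗮ = n := by
    have h1 := LinearMap.finrank_range_add_finrank_ker C
    have h2 := (LinearMap.ker C).finrank_add_finrank_orthogonal
    omega
  let e : OrthonormalBasis (Fin n) ℂ (LinearMap.ker C)ᗮ :=
    (stdOrthonormalBasis ℂ (LinearMap.ker C)ᗮ).reindex (finCongr hK)
  refine ⟨fun k => (e k : H), e.orthonormal.comp_linearIsometry (LinearMap.ker C)ᗮ.subtypeₗᵢ, ?_⟩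
  ext z
  have hz : z - (LinearMap.ker C)ᗮ.starProjection z ∈ LinearMap.ker C := by
    have := (LinearMap.ker C)ᗮ.sub_starProjection_mem_orthogonal z
    rwa [Submodule.orthogonal_orthogonal] at this
  rw [LinearMap.mem_ker, map_sub, sub_eq_zero] at hz
  rw [hz, e.starProjection_eq_sum_rankOne]
  simp

/-- A normal operator has an orthonormal basis of eigenvectors. -/
theorem exists_orthonormalBasis_eigenvectors {T : H →ₗ[ℂ] H} (hT : IsStarNormal T) :
    ∃ (v : OrthonormalBasis (Fin (Module.finrank ℂ H)) ℂ H) (μ : Fin (Module.finrank ℂ H) → ℂ),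
      ∀ i, T (v i) = μ i • v i := by
  classical
  -- T = (A - iB)/2 with A and B symmetric, and they commute because T is normal; joint eigenvectors
  -- of A and B are eigenvectors of T.
  set A : H →ₗ[ℂ] H := T + LinearMap.adjoint T with hA
  set B : H →ₗ[ℂ] H := Complex.I • (T - LinearMap.adjoint T) with hB
  have hAs : A.IsSymmetric := fun x y => by
    simp only [hA, LinearMap.add_apply, inner_add_left, inner_add_right,
      LinearMap.adjoint_inner_left, LinearMap.adjoint_inner_right]
    ring
  have hBs : B.IsSymmetric := fun x y => by
    simp only [hB, LinearMap.smul_apply, LinearMap.sub_apply, inner_sub_left, inner_sub_right,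
      inner_smul_left, inner_smul_right,
      LinearMap.adjoint_inner_left, LinearMap.adjoint_inner_right, Complex.conj_I]
    ring
  have hcomm : Commute T (LinearMap.adjoint T) := hT.star_comm_self.symm
  have hAB : Commute A B := by
    refine Commute.smul_right ?_ _
    exact ((Commute.refl T).sub_right hcomm).add_left (hcomm.symm.sub_right (Commute.refl _))
  -- Restricting from all of ℂ × ℂ to pairs of actual eigenvalues makes the index type finite; the
  -- discarded joint eigenspaces are zero.
  let f : Module.End.Eigenvalues B × Module.End.Eigenvalues A → ℂ × ℂ := fun p => (p.1, p.2)
  have hf : Function.Injective f := fun p q h => by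
    simp only [f, Prod.mk.injEq] at h
    exact Prod.ext (Subtype.ext h.1) (Subtype.ext h.2)
  have hfam := (LinearMap.IsSymmetric.orthogonalFamily_eigenspace_inf_eigenspace hAs hBs).comp hf
  have hint : DirectSum.IsInternal fun p : Module.End.Eigenvalues B × Module.End.Eigenvalues A =>
      (Module.End.eigenspace A (f p).2 ⊓ Module.End.eigenspace B (f p).1 : Submodule ℂ H) := by
    refine hfam.isInternal_iff.2 ?_
    rw [Submodule.orthogonal_eq_bot_iff, eq_top_iff,
      ← LinearMap.IsSymmetric.iSup_iSup_eigenspace_inf_eigenspace_eq_top_of_commute hAs hBs hAB]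
    refine iSup_le fun α => iSup_le fun γ => ?_
    by_cases hα : Module.End.HasEigenvalue A α
    · by_cases hγ : Module.End.HasEigenvalue B γ
      · exact le_iSup (fun p : Module.End.Eigenvalues B × Module.End.Eigenvalues A =>
          (Module.End.eigenspace A (f p).2 ⊓ Module.End.eigenspace B (f p).1 : Submodule ℂ H))
          (⟨γ, hγ⟩, ⟨α, hα⟩)
      · have : Module.End.eigenspace B γ = ⊥ := by
          by_contra h
          exact hγ (Module.End.hasEigenvalue_iff.2 h)
        simp [this]
    · have : Module.End.eigenspace A α = ⊥ := by
        by_contra h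
        exact hα (Module.End.hasEigenvalue_iff.2 h)
      simp [this]
  let v := hint.subordinateOrthonormalBasis rfl hfam
  refine ⟨v, fun i => (1 / 2 : ℂ) *
    ((f (hint.subordinateOrthonormalBasisIndex rfl i hfam)).2 -
      Complex.I * (f (hint.subordinateOrthonormalBasisIndex rfl i hfam)).1), fun i => ?_⟩
  obtain ⟨h1, h2⟩ := hint.subordinateOrthonormalBasis_subordinate rfl i hfam
  have h1' := Module.End.mem_eigenspace_iff.1 h1
  have h2' := Module.End.mem_eigenspace_iff.1 h2
  have hTe : ∀ x, T x = (1 / 2 : ℂ) • (A x - Complex.I • B x) := fun x => by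
    simp only [hA, hB, LinearMap.add_apply, LinearMap.smul_apply, LinearMap.sub_apply, smul_smul,
      Complex.I_mul_I]
    module
  rw [hTe, h1', h2', smul_smul, ← sub_smul, smul_smul]

/-- The sum of a rank-one operator and a normal operator living on the orthogonal complement of
its range and corange, as a sum of `rank C` rank-one operators, all but one of which are normal. -/
theorem exists_ketBra_decomposition_of_rank_one_add_normal {C₁ C₂ : H →ₗ[ℂ] H}
    (h₁ : Module.finrank ℂ (LinearMap.range C₁) = 1) (h₂ : IsStarNormal C₂)
    (horth : ∀ (μ : ℂ) (x : H), μ ≠ 0 → Module.End.HasEigenvector C₂ μ x →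
      (∀ y ∈ LinearMap.range C₁, inner ℂ x y = 0) ∧
      (∀ y ∈ LinearMap.range (LinearMap.adjoint C₁), inner ℂ x y = 0)) :
    ∃ (ι : Type) (_ : Fintype ι) (a b : ι → H), Orthonormal ℂ b ∧
      C₁ + C₂ = ∑ k, ketBra (a k) (b k) ∧
      Fintype.card ι = Module.finrank ℂ (LinearMap.range (C₁ + C₂)) ∧
      ∀ l k, l ≠ k → (∃ c : ℂ, a l = c • b l ∧ inner ℂ (b l) (a k) = 0) ∨
        (∃ c : ℂ, a k = c • b k ∧ inner ℂ (b k) (a l) = 0) := by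
  classical
  obtain ⟨b₀, hb₀, hC₁⟩ := exists_orthonormal_eq_sum_ketBra C₁ h₁
  rw [Fin.sum_univ_one] at hC₁
  obtain ⟨v, μ, hv⟩ := exists_orthonormalBasis_eigenvectors h₂
  set p : H := C₁ (b₀ 0) with hp
  set q : H := b₀ 0 with hq
  have hq1 : ‖q‖ = 1 := hb₀.1 0
  have hp0 : p ≠ 0 := by
    intro h
    rw [h, ketBra_zero_left] at hC₁
    rw [hC₁, LinearMap.range_zero, finrank_bot] at h₁
    exact zero_ne_one h₁
  have hvp : ∀ i, μ i ≠ 0 → inner ℂ (v i) p = 0 ∧ inner ℂ (v i) q = 0 := by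
    intro i hi
    have hev : Module.End.HasEigenvector C₂ (μ i) (v i) :=
      ⟨Module.End.mem_eigenspace_iff.2 (hv i), v.orthonormal.ne_zero i⟩
    obtain ⟨ho₁, ho₂⟩ := horth _ _ hi hev
    refine ⟨ho₁ p ⟨q, rfl⟩, ?_⟩
    -- C₁* p = ‖p‖² q with p ≠ 0, so q lies in the range of C₁*.
    have := ho₂ _ ⟨p, rfl⟩
    rw [hC₁, adjoint_ketBra, ketBra_apply, inner_smul_right, mul_eq_zero] at this
    exact this.resolve_left (by simpa using hp0)
  -- Zero eigenvalues are dropped: orthogonality is assumed only for the others, and the number of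
  -- terms must equal the rank.
  let S := {i // μ i ≠ 0}
  have hC₂ : C₂ = ∑ i : S, ketBra (μ i • v i) (v i) := by
    have hall : C₂ = ∑ i, ketBra (μ i • v i) (v i) := by
      refine v.toBasis.ext fun j => ?_
      simp [hv, v.inner_eq_ite]
    have hne : ∀ i ∈ Finset.univ, ketBra (μ i • v i) (v i) ≠ 0 → μ i ≠ 0 := fun i _ h hμ =>
      h (by rw [hμ, zero_smul, ketBra_zero_left])
    rw [← Finset.sum_filter_of_ne hne] at hall
    exact hall.trans (Finset.sum_subtype _ (by simp) _)
  let a : Option S → H := fun o => o.elim p fun i => μ i • v i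
  let b : Option S → H := fun o => o.elim q fun i => v i
  have hb : Orthonormal ℂ b := by
    refine ⟨?_, ?_⟩
    · rintro (_ | i)
      · exact hq1
      · exact v.orthonormal.1 i
    · rintro (_ | i) (_ | j) hij
      · exact absurd rfl hij
      · exact inner_eq_zero_symm.1 (hvp j j.2).2
      · exact (hvp i i.2).2
      · exact v.orthonormal.2 fun h => hij (by rw [Subtype.ext h])
  have hpair : ∀ l k, l ≠ k → (∃ c : ℂ, a l = c • b l ∧ inner ℂ (b l) (a k) = 0) ∨
        (∃ c : ℂ, a k = c • b k ∧ inner ℂ (b k) (a l) = 0) := by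
    rintro (_ | i) (_ | j) hij
    · exact absurd rfl hij
    · exact Or.inr ⟨μ j, rfl, (hvp j j.2).1⟩
    · exact Or.inl ⟨μ i, rfl, (hvp i i.2).1⟩
    · refine Or.inl ⟨μ i, rfl, ?_⟩
      have : inner ℂ (v i) (v j) = 0 := v.orthonormal.2 fun h => hij (by rw [Subtype.ext h])
      change inner ℂ (v i) (μ j • v j) = 0
      rw [inner_smul_right, this, mul_zero]
  have hsum : C₁ + C₂ = ∑ k, ketBra (a k) (b k) := by
    rw [Fintype.sum_option]
    exact congrArg₂ (· + ·) hC₁ hC₂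
  -- The kets are nonzero and pairwise orthogonal, which is what makes the number of terms the rank
  -- of C₁ + C₂.
  have ha : LinearIndependent ℂ a := by
    refine linearIndependent_of_ne_zero_of_inner_eq_zero ?_ ?_
    · rintro (_ | i)
      · exact hp0
      · exact smul_ne_zero i.2 (v.orthonormal.ne_zero i)
    · intro l k hlk
      rcases hpair l k hlk with ⟨c, h, h'⟩ | ⟨c, h, h'⟩
      · change inner ℂ (a l) (a k) = 0
        rw [h, inner_smul_left, h', mul_zero]
      · change inner ℂ (a l) (a k) = 0
        rw [h, inner_smul_right, inner_eq_zero_symm.1 h', mul_zero]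
  refine ⟨Option S, inferInstance, a, b, hb, hsum, ?_, hpair⟩
  rw [hsum, finrank_range_sum_ketBra hb ha]

end Decompositions

/-! ### Bounds in terms of the rank, and the theorem -/

section RankBounds

variable {H₁ H₂ : Type*} [NormedAddCommGroup H₁] [InnerProductSpace ℂ H₁]
  [FiniteDimensional ℂ H₁] [NormedAddCommGroup H₂] [InnerProductSpace ℂ H₂]
  [FiniteDimensional ℂ H₂]

theorem abs_hsNorm_sq_partialTrace_sub_le_rank (C : H₁ ⊗[ℂ] H₂ →ₗ[ℂ] H₁ ⊗[ℂ] H₂) {r : ℕ}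
    (hr : r = Module.finrank ℂ (LinearMap.range C)) :
    |hsNorm (partialTrace₁ C) ^ 2 - hsNorm (partialTrace₂ C) ^ 2| ≤
      (r : ℝ) * hsNorm C ^ 2 - 1 / (r : ℝ) * ‖LinearMap.trace ℂ (H₁ ⊗[ℂ] H₂) C‖ ^ 2 := by
  obtain ⟨b, hb, hC⟩ := exists_orthonormal_eq_sum_ketBra C hr.symm
  have h := abs_hsNorm_sq_partialTrace_sub_le_of_orthonormal (fun k => C (b k)) hb
  have hc := hsNorm_sq_sum_ketBra (a := fun k => C (b k)) hb
  have ht := trace_sum_ketBra_tensor (fun k => C (b k)) b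
  rw [← ht, ← hc, ← hC, Fintype.card_fin] at h
  exact h

theorem hsNorm_sq_partialTrace_add_le_rank {C₁ C₂ : H₁ ⊗[ℂ] H₂ →ₗ[ℂ] H₁ ⊗[ℂ] H₂} {r : ℕ}
    (hr : r = Module.finrank ℂ (LinearMap.range (C₁ + C₂)))
    (h₁ : Module.finrank ℂ (LinearMap.range C₁) = 1) (h₂ : IsStarNormal C₂)
    (horth : ∀ (μ : ℂ) (x : H₁ ⊗[ℂ] H₂), μ ≠ 0 → Module.End.HasEigenvector C₂ μ x →
      (∀ y ∈ LinearMap.range C₁, inner ℂ x y = 0) ∧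
      (∀ y ∈ LinearMap.range (LinearMap.adjoint C₁), inner ℂ x y = 0)) :
    hsNorm (partialTrace₁ (C₁ + C₂)) ^ 2 + hsNorm (partialTrace₂ (C₁ + C₂)) ^ 2 ≤
      (r : ℝ) * hsNorm (C₁ + C₂) ^ 2 +
        1 / (r : ℝ) * ‖LinearMap.trace ℂ (H₁ ⊗[ℂ] H₂) (C₁ + C₂)‖ ^ 2 := by
  obtain ⟨ι, _, a, b, hb, hC, hcard, hpair⟩ :=
    exists_ketBra_decomposition_of_rank_one_add_normal h₁ h₂ horth
  have horthb : ∀ l k, l ≠ k → inner ℂ (b l) (b k) = 0 := fun l k hlk => hb.2 hlk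
  have hself : ∀ (c : ℂ) (l : ι), a l = c • b l → inner ℂ (b l) (a l) = c ∧ ‖a l‖ = ‖c‖ := by
    intro c l h
    have hbl : inner ℂ (b l) (b l) = (1 : ℂ) := inner_self_eq_one_of_norm_eq_one (hb.1 l)
    rw [h, inner_tensor_smul_right, hbl, mul_one, norm_smul, hb.1 l, mul_one]
    exact ⟨rfl, rfl⟩
  have h := hsNorm_sq_partialTrace_add_le_of_pairwise (a := a) (b := b) hb.1 fun l k hlk => by
    rcases hpair l k hlk with ⟨c, h, h'⟩ | ⟨c, h, h'⟩
    · have hs := hself c l h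
      have := two_swapForm_le c (hb.1 l) (hb.1 k) h' (horthb l k hlk)
      rw [hs.1, hs.2, h]
      linarith
    · have hs := hself c k h
      have := two_swapForm_le c (hb.1 k) (hb.1 l) h' (horthb k l hlk.symm)
      rw [hs.1, hs.2, norm_sub_rev, swapForm_symm, h]
      exact this
  have hc := hsNorm_sq_sum_ketBra (a := a) hb
  have ht := trace_sum_ketBra_tensor a b
  rw [← ht, ← hc, ← hC, hcard, ← hr] at h
  exact h

end RankBounds

theorem theorem2 {H₁ H₂ : Type*}
    [NormedAddCommGroup H₁] [InnerProductSpace ℂ H₁] [FiniteDimensional ℂ H₁]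
    [NormedAddCommGroup H₂] [InnerProductSpace ℂ H₂] [FiniteDimensional ℂ H₂]
    (C : H₁ ⊗[ℂ] H₂ →ₗ[ℂ] H₁ ⊗[ℂ] H₂) (r d : ℕ)
    (hr : r = Module.finrank ℂ (LinearMap.range C))
    (hd : d = max (Module.finrank ℂ H₁) (Module.finrank ℂ H₂)) :
    |hsNorm (partialTrace₁ C) ^ 2 - hsNorm (partialTrace₂ C) ^ 2| ≤
        ((min r d : ℕ) : ℝ) * hsNorm C ^ 2
          - 1 / ((min r d : ℕ) : ℝ) * ‖LinearMap.trace ℂ (H₁ ⊗[ℂ] H₂) C‖ ^ 2 ∧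
    hsNorm (partialTrace₁ C) ^ 2 + hsNorm (partialTrace₂ C) ^ 2 ≤
        (d : ℝ) * hsNorm C ^ 2 + 1 / (d : ℝ) * ‖LinearMap.trace ℂ (H₁ ⊗[ℂ] H₂) C‖ ^ 2 ∧
    ((∃ C₁ C₂ : H₁ ⊗[ℂ] H₂ →ₗ[ℂ] H₁ ⊗[ℂ] H₂,
        C = C₁ + C₂ ∧
        Module.finrank ℂ (LinearMap.range C₁) = 1 ∧
        IsStarNormal C₂ ∧
        ∀ (μ : ℂ) (x : H₁ ⊗[ℂ] H₂), μ ≠ 0 → Module.End.HasEigenvector C₂ μ x →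
          (∀ y ∈ LinearMap.range C₁, inner ℂ x y = 0) ∧
          (∀ y ∈ LinearMap.range (LinearMap.adjoint C₁), inner ℂ x y = 0)) →
      hsNorm (partialTrace₁ C) ^ 2 + hsNorm (partialTrace₂ C) ^ 2 ≤
        (r : ℝ) * hsNorm C ^ 2 + 1 / (r : ℝ) * ‖LinearMap.trace ℂ (H₁ ⊗[ℂ] H₂) C‖ ^ 2) := by
  obtain ⟨h₁, h₂⟩ := partialTrace_dimension_bounds C hd
  refine ⟨?_, h₂, ?_⟩
  -- The bounds with r and with d both hold for every C, so whichever value the minimum takes is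
  -- covered.
  · rcases min_choice r d with h | h
    · rw [h]; exact abs_hsNorm_sq_partialTrace_sub_le_rank C hr
    · rw [h]; exact h₁
  · rintro ⟨C₁, C₂, rfl, hrank, hnormal, horth⟩
    exact hsNorm_sq_partialTrace_add_le_rank hr hrank hnormal horth
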